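/- Let $N$ and $k$ be integers with $3\le k<N$, let $p>1$ and $0<\mu<\left(\frac{k-2}{2}\right)^2$. For a real symmetric $N\times N$ matrix $X$ with eigenvalues $\lambda_1\le\dots\le\lambda_N$ put $\mathcal P_k^+(X)=\sum_{i=N-k+1}^{N}\lambda_i$, the sum of the $k$ largest eigenvalues. Set $$\tau^\pm=\frac{k-2}{2}\pm\sqrt{\left(\frac{k-2}{2}\right)^2-\mu},\qquad p^\star=1+\frac{2}{\tau^+},\qquad p^{\star\star}=1+\frac{2}{\tau^-},$$ so that $\tau^\pm$ are the roots of $x^2-(k-2)x+\mu=0$. Let $B(0,1)$ be the open unit ball of $\mathbb R^N$ and let $u\in C^2(B(0,1)\setminus\{0\})$ be a positive radial function, written $u=u(r)$ with $r=|x|$, that satisfies $$\mathcal P_k^+(D^2u)+\mu\,\frac{u}{r^2}=u^p\qquad\text{in } B(0,1)\setminus\{0\}.$$ Then: 1. If $1<p<p^\star$, then at least one of the following holds as $r\to0$: $r^{\frac{2}{p-1}}u(r)\to K$; or $r^{\tau^+}u(r)\to c_1$ for some constant $c_1>0$; or $r^{\tau^-}u(r)\to c_2$ for some constant $c_2>0$.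 Here $K=\left[\left(\frac{2}{p-1}-\tau^+\right)\left(\frac{2}{p-1}-\tau^-\right)\right]^{\frac{1}{p-1}}$. 2. If $p^\star\le p<p^{\star\star}$, then $r^{\tau^-}u(r)\to c_2$ as $r\to0$ for some constant $c_2>0$. 3. If $p=p^{\star\star}$, then $r^{\tau^-}(-\ln r)^{\tau^- /2}\,u(r)\to \bar K$ as $r\to0$, where $\bar K=\left[\tau^-\sqrt{\left(\frac{k-2}{2}\right)^2-\mu}\,\right]^{\tau^- /2}$. 4. If $p>p^{\star\star}$, then $r^{\frac{2}{p-1}}u(r)\to K$ as $r\to0$, with $K$ as in 1. -/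

import Mathlib

open Filter Topology

noncomputable section

/-- The Hessian matrix `D²u(x)`, with entries `∂ᵢ∂ⱼ u(x)`, of a function on `ℝᴺ`. -/
def hessianMatrix {N : ℕ} (u : EuclideanSpace ℝ (Fin N) → ℝ) (x : EuclideanSpace ℝ (Fin N)) :
    Matrix (Fin N) (Fin N) ℝ :=
  Matrix.of fun i j =>
    fderiv ℝ (fderiv ℝ u) x (EuclideanSpace.single i 1) (EuclideanSpace.single j 1)

/-- The Hessian matrix of a function that is `C²` near `x` is symmetric, so that the value of
`truncLaplacianPlus` at it is always given by the eigenvalue formula. -/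
theorem hessianMatrix_isHermitian {N : ℕ} {u : EuclideanSpace ℝ (Fin N) → ℝ}
    {x : EuclideanSpace ℝ (Fin N)} (hu : ContDiffAt ℝ 2 u x) :
    (hessianMatrix u x).IsHermitian := by
  have h : IsSymmSndFDerivAt ℝ u x := hu.isSymmSndFDerivAt (by simp)
  ext i j
  simpa [hessianMatrix, Matrix.conjTranspose_apply] using h.eq _ _

/-- The truncated Laplacian `P_k⁺(X)`: the sum of the `k` largest eigenvalues, counted with
multiplicity, of a real symmetric `N × N` matrix `X`. The eigenvalues `eigenvalues₀` of a symmetric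
matrix are listed in decreasing order, so these are the ones with index `< k`. The value `0` at
matrices that are not symmetric is a dummy. -/
def truncLaplacianPlus {N : ℕ} (k : ℕ) (X : Matrix (Fin N) (Fin N) ℝ) : ℝ :=
  if hX : X.IsHermitian then
    ∑ i ∈ Finset.univ.filter (fun i : Fin (Fintype.card (Fin N)) => i.val < k), hX.eigenvalues₀ i
  else 0

/-- `τ⁺`, the larger root of `x² - (k - 2) x + μ = 0`. -/
def tauPlus (k : ℕ) (μ : ℝ) : ℝ := ((k : ℝ) - 2) / 2 + √((((k : ℝ) - 2) / 2) ^ 2 - μ)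

/-- `τ⁻`, the smaller root of `x² - (k - 2) x + μ = 0`. -/
def tauMinus (k : ℕ) (μ : ℝ) : ℝ := ((k : ℝ) - 2) / 2 - √((((k : ℝ) - 2) / 2) ^ 2 - μ)

/-- `p⋆ = 1 + 2 / τ⁺`. -/
def pStar (k : ℕ) (μ : ℝ) : ℝ := 1 + 2 / tauPlus k μ

/-- `p⋆⋆ = 1 + 2 / τ⁻`. -/
def pStarStar (k : ℕ) (μ : ℝ) : ℝ := 1 + 2 / tauMinus k μ

/-- `K = [(2/(p-1) - τ⁺) (2/(p-1) - τ⁻)]^{1/(p-1)}`. -/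
def constK (k : ℕ) (μ p : ℝ) : ℝ :=
  ((2 / (p - 1) - tauPlus k μ) * (2 / (p - 1) - tauMinus k μ)) ^ (1 / (p - 1))

/-- `K̄ = [τ⁻ √(((k-2)/2)² - μ)]^{τ⁻/2}`. -/
def constKBar (k : ℕ) (μ : ℝ) : ℝ :=
  (tauMinus k μ * √((((k : ℝ) - 2) / 2) ^ 2 - μ)) ^ (tauMinus k μ / 2)

/-- `|x|^τ u(x) → c` as `x → 0`, `x ≠ 0`. -/
def HasPowerLimit {N : ℕ} (u : EuclideanSpace ℝ (Fin N) → ℝ) (τ c : ℝ) : Prop :=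
  Tendsto (fun x => ‖x‖ ^ τ * u x) (𝓝[≠] 0) (𝓝 c)

end

/-!
The Hessian of a radial function has the simple eigenvalue `u''` and the eigenvalue `u' / r` of
multiplicity `N - 1 ≥ k`, so the equation reads
`max(u'', u'/r) + (k - 1) u'/r + μ u/r² = u^p`. With `r = e^{-t}`, `z = -r u'/u`,
`w = r² u^{p-1}` and `α = 2/(p-1)` it becomes the planar system
`max(z' + z² + 2z, 0) = k z - μ + w`, `w' = (p-1) w (z - α)` (`emdenOrbit_of_radial`). Wherever
`k z - μ + w > 0`, this says `z' = w - F(z)`, with `F(x) = (x - τ⁺)(x - τ⁻)`. At the remaining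
times `k z - μ + w` is minimal, and this forces `z > α` (`EmdenOrbit.of_slack_eq_zero`).

All orbits considered are global in `t`, and they converge. The sign of `z - α` is eventually
constant or `w` is eventually constant (`EmdenOrbit.trichotomy`), so `w` is eventually monotone; it
is bounded, since otherwise it would blow up in finite time (`EmdenOrbit.not_tendsto_atTop`). Once
`w` converges, `z` crosses almost every level in one direction only, and so it converges too
(`EmdenOrbit.exists_tendsto_z`). Hence (`EmdenOrbit.tendsto_or_tendsto`) either `w → F(α) > 0`,
which is `u ~ K r^{-α}`, or `w → 0` and `z` tends to a root `l ≤ α` of `F`, with `z < α`.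

The four ranges of `p` are the positions of `α` relative to `τ⁻ < τ⁺`. The first alternative
requires `F(α) > 0`, and the second a root `l ≤ α`. If `l < α` then `w` decays
exponentially and `r^l u` has a positive limit (`EmdenOrbit.exists_tendsto_log`). If `l = α = τ⁺`,
then `α - z` decays exponentially and `w` cannot vanish at infinity
(`EmdenOrbit.not_tendsto_larger_root`). If `l = α = τ⁻`, the orbit approaches its limit along the
curve `α - z ≈ w / (τ⁺ - τ⁻)`, on which `w` decays like `1 / t`: this is the logarithmic correction
(`EmdenOrbit.tendsto_mul_of_smaller_root`).
-/

/-! ### Differentiable functions on a half-line -/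

theorem antitoneOn_Ici_of_hasDerivAt_nonpos {f f' : ℝ → ℝ} {T : ℝ}
    (hf : ∀ t ≥ T, HasDerivAt f (f' t) t) (h : ∀ t ≥ T, f' t ≤ 0) :
    AntitoneOn f (Set.Ici T) := by
  refine antitoneOn_of_hasDerivWithinAt_nonpos (f' := f') (convex_Ici T)
    (fun t ht => (hf t ht).continuousAt.continuousWithinAt) ?_ ?_
  · intro t ht
    exact (hf t (interior_subset ht)).hasDerivWithinAt
  · intro t ht
    exact h t (interior_subset ht)

theorem monotoneOn_Ici_of_hasDerivAt_nonneg {f f' : ℝ → ℝ} {T : ℝ}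
    (hf : ∀ t ≥ T, HasDerivAt f (f' t) t) (h : ∀ t ≥ T, 0 ≤ f' t) :
    MonotoneOn f (Set.Ici T) := by
  refine monotoneOn_of_hasDerivWithinAt_nonneg (f' := f') (convex_Ici T)
    (fun t ht => (hf t ht).continuousAt.continuousWithinAt) ?_ ?_
  · intro t ht
    exact (hf t (interior_subset ht)).hasDerivWithinAt
  · intro t ht
    exact h t (interior_subset ht)

theorem tendsto_of_antitoneOn_Ici {f : ℝ → ℝ} {T m : ℝ} (hf : AntitoneOn f (Set.Ici T))
    (hm : ∀ t ≥ T, m ≤ f t) : ∃ l, Tendsto f atTop (𝓝 l) ∧ ∀ t ≥ T, l ≤ f t := by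
  have hg : Antitone fun t => f (max t T) := fun a b hab =>
    hf (Set.mem_Ici.2 (le_max_right _ _)) (Set.mem_Ici.2 (le_max_right _ _))
      (max_le_max_right T hab)
  have hb : BddBelow (Set.range fun t => f (max t T)) :=
    ⟨m, by rintro _ ⟨t, rfl⟩; exact hm _ (le_max_right _ _)⟩
  refine ⟨_, (tendsto_atTop_ciInf hg hb).congr' ?_, fun t ht => ?_⟩
  · filter_upwards [eventually_ge_atTop T] with t ht
    rw [max_eq_left ht]
  · exact (ciInf_le hb t).trans_eq (by rw [max_eq_left ht])

theorem tendsto_atTop_of_le_hasDerivAt {f f' : ℝ → ℝ} {c : ℝ} (hc : 0 < c)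
    (hf : ∀ᶠ t in atTop, HasDerivAt f (f' t) t) (h : ∀ᶠ t in atTop, c ≤ f' t) :
    Tendsto f atTop atTop := by
  obtain ⟨T, hT⟩ := eventually_atTop.1 (hf.and h)
  have hm : MonotoneOn (fun t => f t - c * t) (Set.Ici T) :=
    monotoneOn_Ici_of_hasDerivAt_nonneg (f' := fun t => f' t - c * 1)
      (fun t ht => (hT t ht).1.sub ((hasDerivAt_id t).const_mul c))
      (fun t ht => by linarith [(hT t ht).2])
  refine tendsto_atTop_mono' atTop (f₁ := fun t => c * t + (f T - c * T)) ?_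
    (tendsto_atTop_add_const_right _ _ (tendsto_id.const_mul_atTop hc))
  filter_upwards [eventually_ge_atTop T] with t ht
  have := hm Set.self_mem_Ici ht ht
  simp only at this
  linarith

theorem tendsto_atBot_of_hasDerivAt_le {f f' : ℝ → ℝ} {c : ℝ} (hc : 0 < c)
    (hf : ∀ᶠ t in atTop, HasDerivAt f (f' t) t) (h : ∀ᶠ t in atTop, f' t ≤ -c) :
    Tendsto f atTop atBot := by
  rw [← tendsto_neg_atTop_iff]
  exact tendsto_atTop_of_le_hasDerivAt hc (hf.mono fun t ht => ht.neg)
    (h.mono fun t ht => by linarith)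

/-- If a function and its derivative both converge at infinity, the derivative tends to `0`. -/
theorem eq_zero_of_tendsto_of_tendsto_deriv {f f' : ℝ → ℝ} {l d : ℝ}
    (hf : ∀ᶠ t in atTop, HasDerivAt f (f' t) t) (hl : Tendsto f atTop (𝓝 l))
    (hd : Tendsto f' atTop (𝓝 d)) : d = 0 := by
  rcases lt_trichotomy d 0 with h | h | h
  · exact absurd hl (not_tendsto_nhds_of_tendsto_atBot
      (tendsto_atBot_of_hasDerivAt_le (c := -d / 2) (by linarith) hf
        ((hd.eventually_le_const (u := -(-d / 2)) (by linarith)))) l)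
  · exact h
  · exact absurd hl (not_tendsto_nhds_of_tendsto_atTop
      (tendsto_atTop_of_le_hasDerivAt (c := d / 2) (by linarith) hf
        (hd.eventually_const_le (by linarith))) l)

theorem HasDerivAt.eventually_gt_nhdsGT {f : ℝ → ℝ} {d x : ℝ} (hf : HasDerivAt f d x)
    (hd : 0 < d) : ∀ᶠ y in 𝓝[>] x, f x < f y := by
  have h := (hasDerivAt_iff_tendsto_slope.1 hf).eventually_const_lt hd
  filter_upwards [h.filter_mono (nhdsWithin_mono x fun y hy => ne_of_gt hy), self_mem_nhdsWithin]
    with y hy hxy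
  rw [slope_def_field] at hy
  have hxy' : 0 < y - x := sub_pos.2 hxy
  have := (div_pos_iff_of_pos_right hxy').1 hy
  linarith

theorem HasDerivAt.eventually_lt_nhdsLT {f : ℝ → ℝ} {d x : ℝ} (hf : HasDerivAt f d x)
    (hd : 0 < d) : ∀ᶠ y in 𝓝[<] x, f y < f x := by
  have h := (hasDerivAt_iff_tendsto_slope.1 hf).eventually_const_lt hd
  filter_upwards [h.filter_mono (nhdsWithin_mono x fun y hy => ne_of_lt hy), self_mem_nhdsWithin]
    with y hy hxy
  rw [slope_comm, slope_def_field] at hy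
  have hxy' : 0 < x - y := sub_pos.2 hxy
  have := (div_pos_iff_of_pos_right hxy').1 hy
  linarith

/-- A differentiable function that can only cross the level `a` upwards is eventually on one side
of `a`. -/
theorem eventually_lt_or_gt_of_upcrossing {f f' : ℝ → ℝ} {a : ℝ}
    (hf : ∀ᶠ t in atTop, HasDerivAt f (f' t) t) (h : ∀ᶠ t in atTop, f t = a → 0 < f' t) :
    (∀ᶠ t in atTop, f t < a) ∨ ∀ᶠ t in atTop, a < f t := by
  obtain ⟨T, hT⟩ := eventually_atTop.1 (hf.and h)
  by_cases hex : ∃ t₀ ≥ T, a ≤ f t₀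
  · right
    obtain ⟨t₀, ht₀, h₀⟩ := hex
    have hge : ∀ t ≥ t₀, a ≤ f t := by
      intro t ht
      have := image_le_of_deriv_right_lt_deriv_boundary (f := fun t => -f t) (f' := fun t => -f' t)
        (a := t₀) (b := t) (B := fun _ => -a) (B' := fun _ => 0)
        (fun x hx => (hT x (ht₀.trans hx.1)).1.neg.continuousAt.continuousWithinAt)
        (fun x hx => (hT x (ht₀.trans hx.1)).1.neg.hasDerivWithinAt)
        (by simpa using h₀) (fun x => hasDerivAt_const x _)
        (fun x hx hfx => by
          have := (hT x (ht₀.trans hx.1)).2 (by linarith)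
          linarith) (Set.right_mem_Icc.2 ht)
      simpa using this
    filter_upwards [eventually_gt_atTop t₀] with t ht
    refine lt_of_le_of_ne (hge t ht.le) fun hfa => ?_
    have hmin : IsLocalMin f t := by
      filter_upwards [lt_mem_nhds ht] with s hs
      rw [← hfa]
      exact hge s hs.le
    have hTt := hT t (ht₀.trans ht.le)
    have := hmin.hasDerivAt_eq_zero hTt.1
    linarith [hTt.2 hfa.symm]
  · left
    push Not at hex
    exact eventually_atTop.2 ⟨T, hex⟩

theorem eventually_lt_or_gt_of_downcrossing {f f' : ℝ → ℝ} {a : ℝ}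
    (hf : ∀ᶠ t in atTop, HasDerivAt f (f' t) t) (h : ∀ᶠ t in atTop, f t = a → f' t < 0) :
    (∀ᶠ t in atTop, f t < a) ∨ ∀ᶠ t in atTop, a < f t := by
  have := eventually_lt_or_gt_of_upcrossing (a := -a) (hf.mono fun t ht => ht.neg)
    (h.mono fun t ht hta => by
      have := ht (neg_injective hta)
      linarith)
  simpa [or_comm] using this

/-- If `w` increases where `z > a`, and `z` increases at the points where `z = a` and `w > b`,
then from a point with `z = a` and `w > b` on one has `z > a` for ever. -/
theorem forall_gt_of_coupled {z z' w w' : ℝ → ℝ} {a b t₀ : ℝ}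
    (hz : ∀ t ≥ t₀, HasDerivAt z (z' t) t) (hw : ∀ t ≥ t₀, HasDerivAt w (w' t) t)
    (hww : ∀ t ≥ t₀, a ≤ z t → 0 ≤ w' t) (hzz : ∀ t ≥ t₀, z t = a → b < w t → 0 < z' t)
    (hz₀ : z t₀ = a) (hw₀ : b < w t₀) : ∀ t > t₀, a < z t := by
  intro t₁ ht₁
  by_contra! hle
  have hev := (hz t₀ le_rfl).eventually_gt_nhdsGT (hzz t₀ le_rfl hz₀ hw₀)
  obtain ⟨u, hu, hu'⟩ := (mem_nhdsGT_iff_exists_Ioc_subset).1 hev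
  rw [hz₀] at hu'
  have hut : u < t₁ := by
    by_contra! h
    exact absurd (hu' ⟨ht₁, h⟩) (not_lt.2 hle)
  have hcont : ContinuousOn z (Set.Icc u t₁) := fun x hx =>
    (hz x (le_of_lt (hu.trans_le hx.1))).continuousAt.continuousWithinAt
  -- At the first return `s` to the level `a`, `w` has not decreased, so `z` would have to increase.
  obtain ⟨s, ⟨hsI, hsz⟩, hsmin⟩ := (isCompact_Icc.of_isClosed_subset
    (hcont.preimage_isClosed_of_isClosed isClosed_Icc (isClosed_Iic (a := a)))
    Set.inter_subset_left).exists_isLeast ⟨t₁, Set.right_mem_Icc.2 hut.le, hle⟩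
  have hs₀ : t₀ < s := hu.trans_le hsI.1
  have hbefore : ∀ t ∈ Set.Ioo t₀ s, a < z t := by
    intro t ht
    by_cases htu : t ≤ u
    · exact hu' ⟨ht.1, htu⟩
    · by_contra! h
      exact absurd (hsmin ⟨⟨(not_le.1 htu).le, ht.2.le.trans hsI.2⟩, h⟩) (not_le.2 ht.2)
  have hIoo : Set.Ioo t₀ s ∈ 𝓝[<] s := Ioo_mem_nhdsLT hs₀
  have hsa : z s = a := by
    refine le_antisymm hsz (ge_of_tendsto
      ((hz s hs₀.le).continuousAt.continuousWithinAt (s := Set.Iio s)) ?_)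
    filter_upwards [hIoo] with t ht using (hbefore t ht).le
  have hmono : MonotoneOn w (Set.Icc t₀ s) := by
    refine monotoneOn_of_hasDerivWithinAt_nonneg (f' := w') (convex_Icc _ _)
      (fun t ht => (hw t ht.1).continuousAt.continuousWithinAt) ?_ ?_
    · intro t ht
      exact (hw t (interior_subset ht).1).hasDerivWithinAt
    · intro t ht
      rw [interior_Icc] at ht
      exact hww t ht.1.le (hbefore t ht).le
  have hws : b < w s :=
    hw₀.trans_le (hmono (Set.left_mem_Icc.2 hs₀.le) (Set.right_mem_Icc.2 hs₀.le) hs₀.le)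
  obtain ⟨t, ht, ht'⟩ := (((hz s hs₀.le).eventually_lt_nhdsLT (hzz s hs₀.le hsa hws)).and
    hIoo).exists
  linarith [hbefore t ht']

/-- A function whose derivative tends to `c` is asymptotic to `c t`. -/
theorem tendsto_div_of_tendsto_hasDerivAt {f f' : ℝ → ℝ} {c : ℝ}
    (hf : ∀ᶠ t in atTop, HasDerivAt f (f' t) t) (hc : Tendsto f' atTop (𝓝 c)) :
    Tendsto (fun t => f t / t) atTop (𝓝 c) := by
  have hd : ∀ a, ∀ᶠ t in atTop, HasDerivAt (fun t => f t - a * t) (f' t - a * 1) t := fun a =>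
    hf.mono fun t ht => ht.sub ((hasDerivAt_id t).const_mul a)
  refine tendsto_order.2 ⟨fun a ha => ?_, fun a ha => ?_⟩
  · have := tendsto_atTop_of_le_hasDerivAt (c := (c - a) / 2) (by linarith) (hd a)
      ((hc.eventually_const_le (u := (c + a) / 2) (by linarith)).mono fun t ht => by linarith)
    filter_upwards [this.eventually_gt_atTop 0, eventually_gt_atTop 0] with t ht ht0
    rw [lt_div_iff₀ ht0]
    linarith
  · have := tendsto_atBot_of_hasDerivAt_le (c := (a - c) / 2) (by linarith) (hd a)
      ((hc.eventually_le_const (u := (c + a) / 2) (by linarith)).mono fun t ht => by linarith)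
    filter_upwards [this.eventually_lt_atBot 0, eventually_gt_atTop 0] with t ht ht0
    rw [div_lt_iff₀ ht0]
    linarith

/-! ### The planar system in Emden–Fowler variables -/

/-- The indicial polynomial `x² - (k - 2) x + μ`, whose roots are `τ⁺` and `τ⁻`. -/
def indicial (k μ x : ℝ) : ℝ := x ^ 2 - (k - 2) * x + μ

/-- The positive radial solutions of the equation in Emden–Fowler variables. With `r = e^{-t}` and
`α = 2 / β`, `β = p - 1`, the functions are `z = -r u' / u` and `w = r² u^{p - 1}`. The maximum in
`eqn` comes from the two possible positions of the eigenvalue `u''` of the Hessian relative to the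
multiple eigenvalue `u' / r`. -/
structure EmdenOrbit (k μ β α : ℝ) (z z' w : ℝ → ℝ) : Prop where
  two_lt : 2 < k
  mu_pos : 0 < μ
  beta_pos : 0 < β
  beta_mul : β * α = 2
  hasDerivAt_z : ∀ t > 0, HasDerivAt z (z' t) t
  hasDerivAt_w : ∀ t > 0, HasDerivAt w (β * w t * (z t - α)) t
  w_pos : ∀ t > 0, 0 < w t
  eqn : ∀ t > 0, max (z' t + z t ^ 2 + 2 * z t) 0 = k * z t - μ + w t

namespace EmdenOrbit

variable {k μ β α : ℝ} {z z' w : ℝ → ℝ}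

theorem k_pos (h : EmdenOrbit k μ β α z z' w) : 0 < k := by linarith [h.two_lt]

theorem alpha_pos (h : EmdenOrbit k μ β α z z' w) : 0 < α := by
  have := h.beta_pos
  have h2 := h.beta_mul
  by_contra! hα
  nlinarith

theorem slack_nonneg (h : EmdenOrbit k μ β α z z' w) {t : ℝ} (ht : 0 < t) :
    0 ≤ k * z t - μ + w t := h.eqn t ht ▸ le_max_right _ _

theorem deriv_le (h : EmdenOrbit k μ β α z z' w) {t : ℝ} (ht : 0 < t) :
    z' t ≤ w t - indicial k μ (z t) := by
  have := h.eqn t ht ▸ le_max_left (z' t + z t ^ 2 + 2 * z t) 0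
  unfold indicial
  linarith

theorem deriv_eq (h : EmdenOrbit k μ β α z z' w) {t : ℝ} (ht : 0 < t)
    (hs : 0 < k * z t - μ + w t) : z' t = w t - indicial k μ (z t) := by
  have := h.eqn t ht
  rcases max_choice (z' t + z t ^ 2 + 2 * z t) 0 with hm | hm
  · unfold indicial
    linarith
  · linarith

/-- The second-order equation can degenerate to the first-order one only in the region `z > α`,
where `w` increases: at such a time the nonnegative quantity `k z - μ + w` attains its minimum `0`,
so that its derivative vanishes. -/
theorem of_slack_eq_zero (h : EmdenOrbit k μ β α z z' w) {t : ℝ} (ht : 0 < t)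
    (hs : k * z t - μ + w t = 0) : 0 < z t ∧ α < z t ∧ z' t < 0 := by
  have hmin : IsLocalMin (fun s => k * z s - μ + w s) t := by
    filter_upwards [lt_mem_nhds ht] with s hs'
    rw [hs]
    exact h.slack_nonneg hs'
  have hd := hmin.hasDerivAt_eq_zero
    ((((h.hasDerivAt_z t ht).const_mul k).sub_const μ).add (h.hasDerivAt_w t ht))
  have hle : z' t + z t ^ 2 + 2 * z t ≤ 0 := (le_max_left _ _).trans_eq ((h.eqn t ht).trans hs)
  have hw := h.w_pos t ht
  have hk := h.k_pos
  have hμ := h.mu_pos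
  have hβ := h.beta_pos
  have hβα := h.beta_mul
  have h1 : k * (z' t + z t ^ 2 + 2 * z t) ≤ 0 := mul_nonpos_of_nonneg_of_nonpos hk.le hle
  have h2 : β * w t * (z t - α) = β * w t * z t - 2 * w t := by linear_combination (-w t) * hβα
  have h3 : 0 < β * w t * z t := by nlinarith [mul_nonneg hk.le (sq_nonneg (z t))]
  have hz : 0 < z t := (pos_iff_pos_of_mul_pos h3).1 (mul_pos hβ hw)
  have h4 : z' t < 0 := by nlinarith
  have h5 : 0 < β * w t * (z t - α) := by nlinarith
  have h6 := (pos_iff_pos_of_mul_pos h5).1 (mul_pos hβ hw)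
  exact ⟨hz, by linarith, h4⟩

theorem slack_pos (h : EmdenOrbit k μ β α z z' w) {t : ℝ} (ht : 0 < t) (hz : z t ≤ α) :
    0 < k * z t - μ + w t :=
  lt_of_le_of_ne (h.slack_nonneg ht) fun h0 =>
    absurd (h.of_slack_eq_zero ht h0.symm).2.1 (not_lt.2 hz)

theorem deriv_eq_of_le (h : EmdenOrbit k μ β α z z' w) {t : ℝ} (ht : 0 < t) (hz : z t ≤ α) :
    z' t = w t - indicial k μ (z t) := h.deriv_eq ht (h.slack_pos ht hz)

theorem mul_w_pos (h : EmdenOrbit k μ β α z z' w) {t : ℝ} (ht : 0 < t) : 0 < β * w t :=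
  mul_pos h.beta_pos (h.w_pos t ht)

theorem hasDerivAt_log_w (h : EmdenOrbit k μ β α z z' w) {t : ℝ} (ht : 0 < t) :
    HasDerivAt (fun t => Real.log (w t)) (β * (z t - α)) t := by
  refine ((h.hasDerivAt_w t ht).log (h.w_pos t ht).ne').congr_deriv ?_
  rw [div_eq_iff (h.w_pos t ht).ne']
  ring

/-- An orbit is eventually on one side of the line `z = α`, on which `w` is stationary, unless `w`
is eventually constant. -/
theorem trichotomy (h : EmdenOrbit k μ β α z z' w) :
    (∀ᶠ t in atTop, α < z t) ∨ (∀ᶠ t in atTop, z t < α) ∨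
      ∀ᶠ t in atTop, w t = indicial k μ α := by
  -- On `z = α` one has `z' = w - indicial k μ α`: a crossing at a larger or smaller value of `w` is
  -- the last one.
  by_cases h1 : ∃ t₀ > 0, z t₀ = α ∧ indicial k μ α < w t₀
  · left
    obtain ⟨t₀, ht₀, hz₀, hw₀⟩ := h1
    have := forall_gt_of_coupled (a := α) (b := indicial k μ α)
      (fun t ht => h.hasDerivAt_z t (ht₀.trans_le ht))
      (fun t ht => h.hasDerivAt_w t (ht₀.trans_le ht))
      (fun t ht hz => mul_nonneg (h.mul_w_pos (ht₀.trans_le ht)).le (sub_nonneg.2 hz))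
      (fun t ht hz hw => by
        rw [h.deriv_eq_of_le (ht₀.trans_le ht) hz.le, hz]
        linarith) hz₀ hw₀
    exact (eventually_gt_atTop t₀).mono this
  by_cases h2 : ∃ t₀ > 0, z t₀ = α ∧ w t₀ < indicial k μ α
  · right; left
    obtain ⟨t₀, ht₀, hz₀, hw₀⟩ := h2
    have := forall_gt_of_coupled (a := -α) (b := -indicial k μ α)
      (fun t ht => (h.hasDerivAt_z t (ht₀.trans_le ht)).neg)
      (fun t ht => (h.hasDerivAt_w t (ht₀.trans_le ht)).neg)
      (fun t ht hz => by
        have hz' : z t ≤ α := neg_le_neg_iff.1 hz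
        have := mul_nonneg (h.mul_w_pos (ht₀.trans_le ht)).le (sub_nonneg.2 hz')
        linarith)
      (fun t ht hz hw => by
        have hz' : z t = α := neg_injective hz
        rw [h.deriv_eq_of_le (ht₀.trans_le ht) hz'.le, hz']
        simp only [Pi.neg_apply, neg_lt_neg_iff] at hw
        linarith) (by simp [hz₀]) (by simpa using hw₀)
    exact (eventually_gt_atTop t₀).mono fun t ht => neg_lt_neg_iff.1 (this t ht)
  push Not at h1 h2
  have h0 : ∀ t > 0, z t = α → w t = indicial k μ α := fun t ht hz =>
    le_antisymm (h1 t ht hz) (h2 t ht hz)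
  by_cases hfreq : ∃ᶠ t in atTop, z t = α
  · right; right
    obtain ⟨t₀, ht₀z, ht₀⟩ := (hfreq.and_eventually (eventually_gt_atTop 0)).exists
    filter_upwards [eventually_ge_atTop t₀] with t ht
    obtain ⟨t₁, ht₁z, ht₁⟩ := (hfreq.and_eventually (eventually_ge_atTop t)).exists
    have htI : t ∈ Set.Icc t₀ t₁ := ⟨ht, ht₁⟩
    have hcont : ContinuousOn w (Set.Icc t₀ t₁) := fun x hx =>
      (h.hasDerivAt_w x (ht₀.trans_le hx.1)).continuousAt.continuousWithinAt
    -- `w` takes the value `indicial k μ α` at its extrema on `[t₀, t₁]`: there, `z = α`.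
    have hext : ∀ m ∈ Set.Icc t₀ t₁, IsExtrOn w (Set.Icc t₀ t₁) m → w m = indicial k μ α := by
      intro m hm hex
      have hm0 : 0 < m := ht₀.trans_le hm.1
      rcases eq_or_lt_of_le hm.1 with rfl | hm1
      · exact h0 _ hm0 ht₀z
      rcases eq_or_lt_of_le hm.2 with rfl | hm2
      · exact h0 _ hm0 ht₁z
      have := (hex.isLocalExtr (Icc_mem_nhds hm1 hm2)).hasDerivAt_eq_zero (h.hasDerivAt_w m hm0)
      rcases mul_eq_zero.1 this with h' | h'
      · exact absurd h' (h.mul_w_pos hm0).ne'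
      · exact h0 _ hm0 (sub_eq_zero.1 h')
    obtain ⟨M, hM, hMmax⟩ := isCompact_Icc.exists_isMaxOn ⟨t, htI⟩ hcont
    obtain ⟨m, hm, hmmin⟩ := isCompact_Icc.exists_isMinOn ⟨t, htI⟩ hcont
    refine le_antisymm ?_ ?_
    · rw [← hext M hM hMmax.isExtr]
      exact hMmax htI
    · rw [← hext m hm hmmin.isExtr]
      exact hmmin htI
  · have hne : ∀ᶠ t in atTop, z t ≠ α := not_frequently.1 hfreq
    have := eventually_lt_or_gt_of_upcrossing (a := α)
      ((eventually_gt_atTop 0).mono h.hasDerivAt_z) (hne.mono fun t ht hz => absurd hz ht)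
    tauto

/-- On an orbit `w` cannot tend to infinity: it would satisfy `w' ≥ c w^{3/2}`, hence blow up in
finite time. This replaces the Keller–Osserman bound on the solution. -/
theorem not_tendsto_atTop (h : EmdenOrbit k μ β α z z' w) (hz : ∀ᶠ t in atTop, α < z t) :
    ¬ Tendsto w atTop atTop := by
  intro hw
  have hα := h.alpha_pos
  have hβ := h.beta_pos
  have hs : Tendsto (fun t => √(w t)) atTop atTop := Real.tendsto_sqrt_atTop.comp hw
  have hsd : ∀ᶠ t in atTop,
      HasDerivAt (fun t => √(w t)) (β / 2 * √(w t) * (z t - α)) t := by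
    filter_upwards [eventually_gt_atTop 0] with t ht
    have hsq := Real.sqrt_pos.2 (h.w_pos t ht)
    refine ((h.hasDerivAt_w t ht).sqrt (h.w_pos t ht).ne').congr_deriv ?_
    rw [div_eq_iff (by positivity)]
    linear_combination (-β * (z t - α)) * Real.sq_sqrt (h.w_pos t ht).le
  obtain ⟨c, hc0, hc⟩ : ∃ c : ℝ, 0 < c ∧ c ^ 2 * (1 + β / 2) ≤ 1 / 2 := by
    refine ⟨1 / (2 + β), by positivity, ?_⟩
    rw [div_pow, div_mul_eq_mul_div, div_le_iff₀ (by positivity)]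
    nlinarith
  have hgd : ∀ᶠ t in atTop, HasDerivAt (fun t => z t - c * √(w t))
      (z' t - c * (β / 2 * √(w t) * (z t - α))) t := by
    filter_upwards [eventually_gt_atTop 0, hsd] with t ht hst
    exact (h.hasDerivAt_z t ht).sub (hst.const_mul c)
  have hg1 : ∀ᶠ t in atTop, z t - c * √(w t) ≤ 0 →
      1 ≤ z' t - c * (β / 2 * √(w t) * (z t - α)) := by
    filter_upwards [eventually_gt_atTop 0, hz, hw.eventually_ge_atTop (2 * (μ + 1))]
      with t ht hzt hwt hg
    have hkα : 0 < k * z t := mul_pos h.k_pos (hα.trans hzt)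
    have hμ := h.mu_pos
    have hsq := Real.sqrt_pos.2 (h.w_pos t ht)
    have hss := Real.sq_sqrt (h.w_pos t ht).le
    rw [h.deriv_eq ht (by linarith), indicial]
    set s := √(w t)
    have h1 : z t ^ 2 ≤ c ^ 2 * s ^ 2 := by
      rw [← mul_pow]
      exact pow_le_pow_left₀ (hα.trans hzt).le (by linarith) 2
    have h2 : 0 < (k - 2) * z t := mul_pos (by linarith [h.two_lt]) (hα.trans hzt)
    have h3 : c * (β / 2 * s * (z t - α)) ≤ c * (β / 2 * s * (c * s)) := by
      gcongr
      linarith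
    have h4 := mul_le_mul_of_nonneg_right hc (sq_nonneg s)
    nlinarith
  -- If `z ≤ c √w` for all large times, then `z - c √w` would grow linearly.
  have hpos : ∀ᶠ t in atTop, 0 < z t - c * √(w t) := by
    refine (eventually_lt_or_gt_of_upcrossing hgd (a := 0)
      (hg1.mono fun t ht h0 => by linarith [ht h0.le])).resolve_left fun hneg => ?_
    have htop := tendsto_atTop_of_le_hasDerivAt one_pos hgd
      ((hg1.and hneg).mono fun t ht => ht.1 ht.2.le)
    obtain ⟨t, ht, ht'⟩ := (hneg.and (htop.eventually_gt_atTop 0)).exists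
    linarith
  -- Now `(1 / √w)' = -(β / 2) (z - α) / √w` stays below a negative constant, although `1 / √w > 0`.
  have hbot : Tendsto (fun t => (√(w t))⁻¹) atTop atBot := by
    refine tendsto_atBot_of_hasDerivAt_le (c := β * c / 4) (by positivity)
      (f' := fun t => -(β / 2 * √(w t) * (z t - α)) / √(w t) ^ 2) ?_ ?_
    · filter_upwards [eventually_gt_atTop 0, hsd] with t ht hst
      exact hst.inv (Real.sqrt_pos.2 (h.w_pos t ht)).ne'
    · filter_upwards [eventually_gt_atTop 0, hpos, hs.eventually_ge_atTop (2 * α / c)]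
        with t ht hzt hst
      have hsq := Real.sqrt_pos.2 (h.w_pos t ht)
      rw [div_le_iff₀ hc0] at hst
      rw [div_le_iff₀ (by positivity)]
      have : β / 2 * √(w t) * (c * √(w t) / 2) ≤ β / 2 * √(w t) * (z t - α) := by
        gcongr
        linarith
      linarith
  obtain ⟨t, ht, ht'⟩ := ((eventually_gt_atTop 0).and (hbot.eventually_lt_atBot 0)).exists
  exact absurd ht' (not_lt.2 (inv_nonneg.2 (Real.sqrt_nonneg _)))

theorem isBoundedUnder_ge (h : EmdenOrbit k μ β α z z' w) {W : ℝ}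
    (hw : ∀ᶠ t in atTop, w t ≤ W) : IsBoundedUnder (· ≥ ·) atTop z := by
  refine isBoundedUnder_of_eventually_ge (a := (μ - W) / k) ?_
  filter_upwards [eventually_gt_atTop 0, hw] with t ht hwt
  rw [div_le_iff₀ h.k_pos]
  linarith [h.slack_nonneg ht]

theorem isBoundedUnder_le (h : EmdenOrbit k μ β α z z' w) {W : ℝ}
    (hw : ∀ᶠ t in atTop, w t ≤ W) : IsBoundedUnder (· ≤ ·) atTop z := by
  -- `M` is chosen so that `indicial k μ x > W + 1` for `x ≥ M`.
  obtain ⟨M, hM⟩ : ∃ M, ∀ x ≥ M, W + 1 ≤ indicial k μ x := by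
    refine ⟨k + |W| + 1, fun x hx => ?_⟩
    have h1 := abs_nonneg W
    have h2 := le_abs_self W
    have h3 := h.two_lt
    have h4 := h.mu_pos
    unfold indicial
    nlinarith
  have hd : ∀ᶠ t in atTop, M ≤ z t → z' t ≤ -1 := by
    filter_upwards [eventually_gt_atTop 0, hw] with t ht hwt hMt
    linarith [h.deriv_le ht, hM _ hMt]
  rcases eventually_lt_or_gt_of_downcrossing (a := M)
    ((eventually_gt_atTop 0).mono h.hasDerivAt_z)
    (hd.mono fun t ht hz => by linarith [ht hz.ge]) with hlt | hgt
  · exact isBoundedUnder_of_eventually_le (hlt.mono fun t ht => ht.le)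
  · have := tendsto_atBot_of_hasDerivAt_le one_pos ((eventually_gt_atTop 0).mono h.hasDerivAt_z)
      ((hd.and hgt).mono fun t ht => ht.1 ht.2.le)
    obtain ⟨t, ht, ht'⟩ := (hgt.and (this.eventually_lt_atBot M)).exists
    linarith

theorem finite_indicial_eq (k μ b : ℝ) : {x | indicial k μ x = b}.Finite := by
  have : {x | indicial k μ x = b} ⊆
      {(k - 2) / 2 + √(((k - 2) / 2) ^ 2 - μ + b), (k - 2) / 2 - √(((k - 2) / 2) ^ 2 - μ + b)} := by
    intro x hx
    have hx' : (x - (k - 2) / 2) ^ 2 = ((k - 2) / 2) ^ 2 - μ + b := by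
      rw [← show indicial k μ x = b from hx, indicial]
      ring
    rw [← hx', Real.sqrt_sq_eq_abs]
    rcases abs_choice (x - (k - 2) / 2) with h | h <;> rw [h] <;> simp
  exact (Set.toFinite _).subset this

/-- If `w` converges then `z` converges: as `t → ∞`, the sign with which `z` crosses a level `a` is
constant, for all but finitely many `a`. -/
theorem exists_tendsto_z (h : EmdenOrbit k μ β α z z' w) {b : ℝ} (hw : Tendsto w atTop (𝓝 b)) :
    ∃ l, Tendsto z atTop (𝓝 l) := by
  have hW : ∀ᶠ t in atTop, w t ≤ b + 1 := hw.eventually_le_const (by linarith)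
  have hzd := (eventually_gt_atTop 0).mono h.hasDerivAt_z
  refine tendsto_of_no_upcrossings (s := Set.univ \ ({x | indicial k μ x = b} ∪ {(μ - b) / k}))
    (dense_univ.sdiff_finite ((finite_indicial_eq k μ b).union (Set.finite_singleton _)))
    ?_ (h.isBoundedUnder_le hW) (h.isBoundedUnder_ge hW)
  rintro a ⟨-, ha⟩ c - hac ⟨hfa, hfc⟩
  simp only [Set.mem_union, Set.mem_ofPred_eq, Set.mem_singleton_iff, not_or] at ha
  have hside : (∀ᶠ t in atTop, z t < a) ∨ ∀ᶠ t in atTop, a < z t := by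
    have hlim : Tendsto (fun t => k * a - μ + w t) atTop (𝓝 (k * a - μ + b)) := hw.const_add _
    rcases lt_trichotomy (k * a - μ + b) 0 with hneg | h0 | hpos
    · refine eventually_lt_or_gt_of_upcrossing hzd ?_
      filter_upwards [hlim.eventually_lt_const hneg, eventually_gt_atTop 0] with t ht ht0 hza
      have := h.slack_nonneg ht0
      rw [hza] at this
      linarith
    · refine absurd ?_ ha.2
      rw [eq_div_iff h.k_pos.ne']
      linarith
    · rcases lt_or_gt_of_ne ha.1 with hlt | hgt
      · refine eventually_lt_or_gt_of_upcrossing hzd ?_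
        filter_upwards [hlim.eventually_const_lt hpos, hw.eventually_const_lt hlt,
          eventually_gt_atTop 0] with t ht hwt ht0 hza
        rw [h.deriv_eq ht0 (by rwa [hza]), hza]
        linarith
      · refine eventually_lt_or_gt_of_downcrossing hzd ?_
        filter_upwards [hlim.eventually_const_lt hpos, hw.eventually_lt_const hgt,
          eventually_gt_atTop 0] with t ht hwt ht0 hza
        rw [h.deriv_eq ht0 (by rwa [hza]), hza]
        linarith
  rcases hside with hs | hs
  · obtain ⟨t, ht, ht'⟩ := (hfc.and_eventually hs).exists
    linarith
  · obtain ⟨t, ht, ht'⟩ := (hfa.and_eventually hs).exists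
    linarith

theorem continuous_indicial (k μ : ℝ) : Continuous (indicial k μ) := by
  unfold indicial
  fun_prop

/-- If `w` has a positive limit, the limit is the one of the explicit solution `K r^{-α}`. -/
theorem eq_indicial_of_tendsto (h : EmdenOrbit k μ β α z z' w) {b : ℝ}
    (hw : Tendsto w atTop (𝓝 b)) (hb : 0 < b) : b = indicial k μ α := by
  obtain ⟨l, hl⟩ := h.exists_tendsto_z hw
  have hzd := (eventually_gt_atTop 0).mono h.hasDerivAt_z
  have hlα : l = α := by
    have := eq_zero_of_tendsto_of_tendsto_deriv
      ((eventually_gt_atTop 0).mono fun t ht => h.hasDerivAt_log_w ht)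
      ((Real.continuousAt_log hb.ne').tendsto.comp hw) ((hl.sub_const α).const_mul β)
    have := (mul_eq_zero.1 this).resolve_left h.beta_pos.ne'
    linarith
  rw [hlα] at hl
  have hlim : Tendsto (fun t => k * z t - μ + w t) atTop (𝓝 (k * α - μ + b)) :=
    ((hl.const_mul k).sub_const μ).add hw
  have hα := h.alpha_pos
  have hpos : 0 < k * α - μ + b := by
    have hnn : 0 ≤ k * α - μ + b := ge_of_tendsto hlim
      ((eventually_gt_atTop 0).mono fun t ht => h.slack_nonneg ht)
    refine lt_of_le_of_ne hnn fun h0 => ?_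
    -- otherwise `z' ≤ (k z - μ + w) - z² - 2 z → -α² - 2 α < 0`
    have hlim' : Tendsto (fun t => k * z t - μ + w t - z t ^ 2 - 2 * z t) atTop
        (𝓝 (k * α - μ + b - α ^ 2 - 2 * α)) := (hlim.sub (hl.pow 2)).sub (hl.const_mul 2)
    have := tendsto_atBot_of_hasDerivAt_le hα hzd (by
      filter_upwards [eventually_gt_atTop 0, hlim'.eventually_le_const (u := -α) (by nlinarith)]
        with t ht hle
      have := h.deriv_le ht
      unfold indicial at this
      linarith)
    exact not_tendsto_nhds_of_tendsto_atBot this α hl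
  have hz' : Tendsto z' atTop (𝓝 (b - indicial k μ α)) := by
    refine (hw.sub (((continuous_indicial k μ).tendsto α).comp hl)).congr' ?_
    filter_upwards [eventually_gt_atTop 0, hlim.eventually_const_lt hpos] with t ht hst
    exact (h.deriv_eq ht hst).symm
  linarith [eq_zero_of_tendsto_of_tendsto_deriv hzd hl hz']

/-- Convergence of an orbit: either `u` behaves like the explicit solution `K r^{-α}`, or the
nonlinearity is negligible and the exponent `z` tends to a root of the indicial polynomial. -/
theorem tendsto_or_tendsto (h : EmdenOrbit k μ β α z z' w) :
    (0 < indicial k μ α ∧ Tendsto w atTop (𝓝 (indicial k μ α))) ∨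
      (Tendsto w atTop (𝓝 0) ∧ (∀ᶠ t in atTop, z t < α) ∧
        ∃ l ≤ α, indicial k μ l = 0 ∧ Tendsto z atTop (𝓝 l)) := by
  rcases h.trichotomy with hgt | hlt | heq
  · left
    obtain ⟨T, hT⟩ := eventually_atTop.1 (hgt.and (eventually_gt_atTop 0))
    have hmono : AntitoneOn (fun t => -w t) (Set.Ici T) :=
      antitoneOn_Ici_of_hasDerivAt_nonpos (fun t ht => (h.hasDerivAt_w t (hT t ht).2).neg)
        (fun t ht => neg_nonpos.2
          (mul_nonneg (h.mul_w_pos (hT t ht).2).le (sub_nonneg.2 (hT t ht).1.le)))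
    have hbdd : ∃ W, ∀ t ≥ T, w t ≤ W := by
      by_contra! hunb
      refine h.not_tendsto_atTop hgt (tendsto_atTop.2 fun W => ?_)
      obtain ⟨t, ht, hWt⟩ := hunb W
      filter_upwards [eventually_ge_atTop t] with s hs
      have := hmono ht (ht.trans hs : T ≤ s) hs
      simp only at this
      linarith
    obtain ⟨W, hW⟩ := hbdd
    obtain ⟨l, hl, hl'⟩ := tendsto_of_antitoneOn_Ici hmono (fun t ht => neg_le_neg (hW t ht))
    have hw : Tendsto w atTop (𝓝 (-l)) := by simpa using hl.neg
    have hpos : 0 < -l := by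
      linarith [hl' T le_rfl, h.w_pos T (hT T le_rfl).2]
    have := h.eq_indicial_of_tendsto hw hpos
    rw [← this]
    exact ⟨hpos, hw⟩
  · obtain ⟨T, hT⟩ := eventually_atTop.1 (hlt.and (eventually_gt_atTop 0))
    have hmono : AntitoneOn w (Set.Ici T) :=
      antitoneOn_Ici_of_hasDerivAt_nonpos (fun t ht => h.hasDerivAt_w t (hT t ht).2)
        (fun t ht => mul_nonpos_of_nonneg_of_nonpos (h.mul_w_pos (hT t ht).2).le
          (sub_nonpos.2 (hT t ht).1.le))
    obtain ⟨b, hb, -⟩ := tendsto_of_antitoneOn_Ici hmono (fun t ht => (h.w_pos t (hT t ht).2).le)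
    have hb0 : 0 ≤ b := ge_of_tendsto hb ((eventually_gt_atTop 0).mono fun t ht => (h.w_pos t ht).le)
    rcases hb0.eq_or_lt with rfl | hbpos
    · right
      obtain ⟨l, hl⟩ := h.exists_tendsto_z hb
      refine ⟨hb, hlt, l, le_of_tendsto hl (hlt.mono fun t ht => ht.le), ?_, hl⟩
      have hz' : Tendsto z' atTop (𝓝 (0 - indicial k μ l)) := by
        refine (hb.sub (((continuous_indicial k μ).tendsto l).comp hl)).congr' ?_
        filter_upwards [eventually_gt_atTop 0, hlt] with t ht hzt
        exact (h.deriv_eq_of_le ht hzt.le).symm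
      linarith [eq_zero_of_tendsto_of_tendsto_deriv
        ((eventually_gt_atTop 0).mono h.hasDerivAt_z) hl hz']
    · left
      have := h.eq_indicial_of_tendsto hb hbpos
      rw [← this]
      exact ⟨hbpos, hb⟩
  · left
    obtain ⟨t, ht, ht0⟩ := (heq.and (eventually_gt_atTop 0)).exists
    exact ⟨ht ▸ h.w_pos t ht0, tendsto_const_nhds.congr' (heq.mono fun t ht => ht.symm)⟩

end EmdenOrbit

/-! ### Rates of convergence -/

namespace EmdenOrbit

variable {k μ β α : ℝ} {z z' w : ℝ → ℝ}

/-- If the exponent tends to a root `l < α`, then `u` is asymptotic to a multiple of `r^{-l}`; the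
function `log w / β + (α - l) t` is `log (r^l u)`. Adding `log (z - σ)`, with `σ` the other root,
makes its derivative equal to `w / (z - σ)`, which is dominated by `-w'`. -/
theorem exists_tendsto_log (h : EmdenOrbit k μ β α z z' w) {l σ : ℝ}
    (hF : ∀ x, indicial k μ x = (x - l) * (x - σ)) (hlσ : l ≠ σ) (hlα : l < α)
    (hw : Tendsto w atTop (𝓝 0)) (hz : Tendsto z atTop (𝓝 l)) :
    ∃ C, Tendsto (fun t => Real.log (w t) / β + (α - l) * t) atTop (𝓝 C) := by
  have hβ := h.beta_pos
  have hzσ : Tendsto (fun t => z t - σ) atTop (𝓝 (l - σ)) := hz.sub_const σ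
  have hne : l - σ ≠ 0 := sub_ne_zero.2 hlσ
  obtain ⟨B, hB⟩ : ∃ B, ∀ᶠ t in atTop, |(z t - σ)⁻¹| ≤ B :=
    ⟨|(l - σ)⁻¹| + 1, ((hzσ.inv₀ hne).abs).eventually_le_const (by linarith)⟩
  obtain ⟨T, hT⟩ := eventually_atTop.1 (((hB.and (hzσ.eventually_ne hne)).and
    (hz.eventually_le_const (u := (l + α) / 2) (by linarith))).and (eventually_gt_atTop 0))
  have hB0 : 0 ≤ B := (abs_nonneg _).trans (hT T le_rfl).1.1.1
  set M : ℝ → ℝ := fun t => Real.log (w t) / β + (α - l) * t + Real.log (z t - σ) with hMdef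
  set A := B / (β * ((α - l) / 2)) with hA
  have hα' : 0 < (α - l) / 2 := by linarith
  have hAβ : A * (β * ((α - l) / 2)) = B := div_mul_cancel₀ _ (by positivity)
  have hA0 : 0 ≤ A := by positivity
  have hMd : ∀ t ≥ T, HasDerivAt M (w t * (z t - σ)⁻¹) t := by
    intro t ht
    obtain ⟨⟨⟨-, hzne⟩, hle⟩, ht0⟩ := hT t ht
    refine (((h.hasDerivAt_log_w ht0).div_const β).add ((hasDerivAt_id t).const_mul (α - l))).add
      (((h.hasDerivAt_z t ht0).sub_const σ).log hzne) |>.congr_deriv ?_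
    rw [h.deriv_eq_of_le ht0 (by linarith), hF]
    field_simp
    ring
  have hdom : ∀ t ≥ T, |w t * (z t - σ)⁻¹| ≤ -(A * (β * w t * (z t - α))) := by
    intro t ht
    obtain ⟨⟨⟨hBt, -⟩, hle⟩, ht0⟩ := hT t ht
    have hwt := h.w_pos t ht0
    rw [abs_mul, abs_of_pos hwt]
    calc w t * |(z t - σ)⁻¹| ≤ w t * B := by gcongr
      _ = A * (β * w t * ((α - l) / 2)) := by rw [← hAβ]; ring
      _ ≤ A * (β * w t * (α - z t)) := by
        have := h.mul_w_pos ht0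
        gcongr
        linarith
      _ = _ := by ring
  have hanti : AntitoneOn (fun t => M t + A * w t) (Set.Ici T) :=
    antitoneOn_Ici_of_hasDerivAt_nonpos
      (fun t ht => (hMd t ht).add ((h.hasDerivAt_w t (hT t ht).2).const_mul A))
      (fun t ht => by linarith [hdom t ht, le_abs_self (w t * (z t - σ)⁻¹)])
  have hmono : MonotoneOn (fun t => M t - A * w t) (Set.Ici T) :=
    monotoneOn_Ici_of_hasDerivAt_nonneg
      (fun t ht => (hMd t ht).sub ((h.hasDerivAt_w t (hT t ht).2).const_mul A))
      (fun t ht => by linarith [hdom t ht, neg_abs_le (w t * (z t - σ)⁻¹)])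
  obtain ⟨C, hC, -⟩ := tendsto_of_antitoneOn_Ici (m := M T - A * w T) hanti (fun t ht => by
    have h1 := hmono Set.self_mem_Ici ht ht
    have h2 := mul_nonneg hA0 (h.w_pos t (hT t ht).2).le
    simp only at h1
    linarith)
  refine ⟨C - A * 0 - Real.log (l - σ), ((hC.sub (hw.const_mul A)).sub
    ((Real.continuousAt_log hne).tendsto.comp hzσ)).congr fun t => ?_⟩
  simp only [hMdef, Function.comp]
  ring

/-- If `α` is the larger root of the indicial polynomial, the exponent cannot tend to `α` from
below: `α - z` would decay exponentially, and `w` would stay away from `0`. -/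
theorem not_tendsto_larger_root (h : EmdenOrbit k μ β α z z' w) {σ : ℝ}
    (hF : ∀ x, indicial k μ x = (x - α) * (x - σ)) (hσ : σ < α)
    (hw : Tendsto w atTop (𝓝 0)) (hlt : ∀ᶠ t in atTop, z t < α) :
    ¬ Tendsto z atTop (𝓝 α) := by
  intro hz
  have hδ : 0 < α - σ := sub_pos.2 hσ
  have hβ := h.beta_pos
  obtain ⟨T, hT⟩ := eventually_atTop.1 ((hlt.and
    (hz.eventually_const_le (u := (α + σ) / 2) (by linarith))).and (eventually_gt_atTop 0))
  have hmono : MonotoneOn (fun t => Real.log (w t) + 2 * β / (α - σ) * z t) (Set.Ici T) := by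
    refine monotoneOn_Ici_of_hasDerivAt_nonneg (fun t ht =>
      (h.hasDerivAt_log_w (hT t ht).2).add ((h.hasDerivAt_z t (hT t ht).2).const_mul _)) ?_
    intro t ht
    obtain ⟨⟨hzt, hle⟩, ht0⟩ := hT t ht
    have hwt := h.w_pos t ht0
    have h1 : (α - z t) * ((α - σ) / 2) ≤ z' t := by
      rw [h.deriv_eq_of_le ht0 hzt.le, hF]
      nlinarith [mul_nonneg (sub_nonneg.2 hzt.le) (show 0 ≤ z t - σ - (α - σ) / 2 by linarith)]
    calc 0 = β * (z t - α) + 2 * β / (α - σ) * ((α - z t) * ((α - σ) / 2)) := by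
          field_simp
          ring
      _ ≤ _ := by gcongr
  have hbot : Tendsto (fun t => Real.log (w t)) atTop atBot :=
    Real.tendsto_log_nhdsGT_zero.comp (tendsto_nhdsWithin_iff.2
      ⟨hw, (eventually_gt_atTop 0).mono fun t ht => h.w_pos t ht⟩)
  have hbot' := hbot.atBot_add (hz.const_mul (2 * β / (α - σ)))
  obtain ⟨t, ht, ht'⟩ := ((eventually_ge_atTop T).and (hbot'.eventually_lt_atBot
    (Real.log (w T) + 2 * β / (α - σ) * z T))).exists
  exact absurd ht' (not_lt.2 (hmono Set.self_mem_Ici ht ht))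

/-- If `α` is the smaller root of the indicial polynomial and `z` tends to `α` from below, then
`(α - z) / w` tends to `1 / δ`, where `δ` is the distance of the roots; so
`(1 / w)' = β (α - z) / w → β / δ`. -/
theorem tendsto_mul_of_smaller_root (h : EmdenOrbit k μ β α z z' w) {δ : ℝ} (hδ : 0 < δ)
    (hF : ∀ x, indicial k μ x = (x - α) * (x - (α + δ))) (hlt : ∀ᶠ t in atTop, z t < α)
    (hz : Tendsto z atTop (𝓝 α)) :
    Tendsto (fun t => w t * t) atTop (𝓝 (δ / β)) := by
  have hβ := h.beta_pos
  have hy : Tendsto (fun t => α - z t) atTop (𝓝 0) := by simpa using hz.const_sub α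
  have hz' : ∀ᶠ t in atTop, z' t = w t - (α - z t) * (α - z t + δ) := by
    filter_upwards [hlt, eventually_gt_atTop 0] with t ht ht0
    rw [h.deriv_eq_of_le ht0 ht.le, hF]
    ring
  set s : ℝ → ℝ := fun t => (α - z t) / w t with hs
  have hspos : ∀ᶠ t in atTop, 0 < s t := by
    filter_upwards [hlt, eventually_gt_atTop 0] with t ht ht0
    exact div_pos (sub_pos.2 ht) (h.w_pos t ht0)
  have hsd : ∀ᶠ t in atTop,
      HasDerivAt s (-1 + s t * (δ + (1 + β) * (α - z t))) t := by
    filter_upwards [hz', eventually_gt_atTop 0] with t ht ht0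
    have hwt := h.w_pos t ht0
    refine (((h.hasDerivAt_z t ht0).const_sub α).div (h.hasDerivAt_w t ht0) hwt.ne').congr_deriv ?_
    rw [ht, hs]
    field_simp
    ring
  have hlin : ∀ a, Tendsto (fun t => -1 + a * (δ + (1 + β) * (α - z t))) atTop
      (𝓝 (-1 + a * δ)) := fun a => by
    simpa using (((hy.const_mul (1 + β)).const_add δ).const_mul a).const_add (-1)
  have hslim : Tendsto s atTop (𝓝 (1 / δ)) := by
    -- `s' = -1 + s (δ + o(1))` is repelled by `1 / δ`: an orbit that left it downwards would make
    -- `s` negative, and one that left it upwards would make `α - z = s w` increase.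
    refine tendsto_order.2 ⟨fun a ha => ?_, fun a ha => ?_⟩
    · rw [lt_div_iff₀ hδ] at ha
      refine (eventually_lt_or_gt_of_downcrossing (a := a) hsd ?_).resolve_left fun hsa => ?_
      · filter_upwards [(hlin a).eventually_lt_const (by linarith : -1 + a * δ < 0)] with t ht hst
        rwa [hst]
      · have := tendsto_atBot_of_hasDerivAt_le (c := (1 - a * δ) / 2) (by linarith) hsd (by
          filter_upwards [hsa, hlt, (hlin a).eventually_le_const
            (u := -((1 - a * δ) / 2)) (by linarith)] with t hst hzt hle
          have h1 : 0 ≤ δ + (1 + β) * (α - z t) := by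
            have := sub_pos.2 hzt
            positivity
          linarith [mul_le_mul_of_nonneg_right hst.le h1])
        obtain ⟨t, ht, ht'⟩ := (hspos.and (this.eventually_lt_atBot 0)).exists
        linarith
    · have ha0 : 0 < a := (by positivity : 0 < 1 / δ).trans ha
      rw [gt_iff_lt, div_lt_iff₀ hδ] at ha
      refine (eventually_lt_or_gt_of_upcrossing (a := a) hsd ?_).resolve_right fun hsa => ?_
      · filter_upwards [(hlin a).eventually_const_lt (by linarith : 0 < -1 + a * δ)] with t ht hst
        rwa [hst]
      · -- `α - z` would be positive and increasing
        obtain ⟨T, hT⟩ := eventually_atTop.1 (((hsa.and hlt).and hz').and (eventually_gt_atTop 0))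
        have hanti : AntitoneOn z (Set.Ici T) := by
          refine antitoneOn_Ici_of_hasDerivAt_nonpos
            (fun t ht => h.hasDerivAt_z t (hT t ht).2) fun t ht => ?_
          obtain ⟨⟨⟨hst, hzt⟩, hz't⟩, ht0⟩ := hT t ht
          rw [hs, lt_div_iff₀ (h.w_pos t ht0)] at hst
          rw [hz't]
          have hwt := h.w_pos t ht0
          nlinarith [mul_pos (sub_pos.2 hzt) (sub_pos.2 hzt), mul_pos hwt (sub_pos.2 ha)]
        have : α ≤ z T := le_of_tendsto hz (by
          filter_upwards [eventually_ge_atTop T] with t ht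
          exact hanti Set.self_mem_Ici ht ht)
        linarith [(hT T le_rfl).1.1.2]
  have hinv : Tendsto (fun t => (w t)⁻¹ / t) atTop (𝓝 (β * (1 / δ))) := by
    refine tendsto_div_of_tendsto_hasDerivAt (f' := fun t => β * s t) ?_ (hslim.const_mul β)
    filter_upwards [eventually_gt_atTop 0] with t ht0
    have hwt := h.w_pos t ht0
    refine ((h.hasDerivAt_w t ht0).inv hwt.ne').congr_deriv ?_
    rw [hs]
    field_simp
    ring
  have := hinv.inv₀ (by positivity)
  refine (this.congr' ?_).trans_eq ?_
  · filter_upwards with t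
    rw [inv_div, div_inv_eq_mul, mul_comm]
  · rw [show (β * (1 / δ))⁻¹ = δ / β by field_simp]

end EmdenOrbit

/-! ### The truncated Laplacian of a radial function -/

/-- A decreasing family with values in `{a, b}` whose sum is that of one `a` and `n - 1` times `b`:
if `a ≥ b` the value `a` is taken first, and otherwise last. -/
theorem sum_filter_lt_of_antitone {n k : ℕ} (hk : 1 ≤ k) (hkn : k < n) {e : Fin n → ℝ}
    (he : Antitone e) {a b : ℝ} (hab : ∀ i, e i = a ∨ e i = b) (hsum : ∑ i, e i = a + (n - 1) * b) :
    ∑ i ∈ Finset.univ.filter (fun i : Fin n => i.val < k), e i = max a b + (k - 1) * b := by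
  have hd : ∑ i, (e i - b) = a - b := by
    rw [Finset.sum_sub_distrib, hsum]
    simp
    ring
  have hcard : (Finset.univ.filter (fun i : Fin n => i.val < k)).card = k := by
    rw [Fin.card_filter_val_lt, min_eq_right hkn.le]
  have hpart : ∑ i ∈ Finset.univ.filter (fun i : Fin n => i.val < k), e i =
      ∑ i ∈ Finset.univ.filter (fun i : Fin n => i.val < k), (e i - b) + k * b := by
    rw [Finset.sum_sub_distrib, Finset.sum_const, hcard, nsmul_eq_mul]
    ring
  rw [hpart]
  rcases le_or_gt b a with hba | hba
  · have hnn : ∀ i, 0 ≤ e i - b := fun i => by rcases hab i with h | h <;> rw [h] <;> linarith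
    have htail : ∀ i : Fin n, ¬ i.val < k → e i - b = 0 := by
      intro i hi
      rcases hab i with h | h
      · let i₀ : Fin n := ⟨0, by omega⟩
        have hne : i₀ ≠ i := fun h0 => hi (by rw [← h0]; exact hk)
        have h1 : e i ≤ e i₀ := he (Fin.mk_le_of_le_val (Nat.zero_le _))
        have h2 : ∑ j ∈ {i₀, i}, (e j - b) ≤ ∑ j, (e j - b) :=
          Finset.sum_le_sum_of_subset_of_nonneg (Finset.subset_univ _) fun j _ _ => hnn j
        rw [Finset.sum_pair hne, hd] at h2
        linarith [hnn i]
      · rw [h, sub_self]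
    rw [Finset.sum_subset (Finset.filter_subset _ _)
      (fun i _ hi => htail i (by simpa using hi)), hd, max_eq_left hba]
    ring
  · have hnp : ∀ i, e i - b ≤ 0 := fun i => by rcases hab i with h | h <;> rw [h] <;> linarith
    have hhead : ∀ i : Fin n, i.val < k → e i - b = 0 := by
      intro i hi
      rcases hab i with h | h
      · let i₁ : Fin n := ⟨n - 1, by omega⟩
        have hne : i ≠ i₁ := fun h0 => by
          have : i.val = n - 1 := by rw [h0]
          omega
        have h1 : e i₁ ≤ e i := he (Fin.mk_le_mk.2 (by omega) : (⟨i.val, i.isLt⟩ : Fin n) ≤ i₁)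
        have h2 : ∑ j, -(e j - b) ≥ ∑ j ∈ {i, i₁}, -(e j - b) :=
          Finset.sum_le_sum_of_subset_of_nonneg (Finset.subset_univ _) fun j _ _ => by
            linarith [hnp j]
        rw [Finset.sum_pair hne, Finset.sum_neg_distrib, hd] at h2
        linarith [hnp i]
      · rw [h, sub_self]
    rw [Finset.sum_eq_zero fun i hi => hhead i (by simpa using hi), max_eq_right hba.le]
    ring

/-- The matrix `b I + c x xᵀ` has the simple eigenvalue `b + c |x|²` and the eigenvalue `b` of
multiplicity `N - 1`. -/
theorem truncLaplacianPlus_eq {N k : ℕ} (hk : 1 ≤ k) (hkN : k < N) {X : Matrix (Fin N) (Fin N) ℝ}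
    (hX : X.IsHermitian) {b c : ℝ} {x : EuclideanSpace ℝ (Fin N)}
    (h : ∀ i j, X i j = (if i = j then b else 0) + c * (x i * x j)) :
    truncLaplacianPlus k X = max (b + c * ‖x‖ ^ 2) b + (k - 1) * b := by
  have hnorm : ‖x‖ ^ 2 = ∑ i, x i * x i := by
    rw [EuclideanSpace.real_norm_sq_eq]
    simp only [sq]
  have heig : ∀ i, hX.eigenvalues i = b + c * ‖x‖ ^ 2 ∨ hX.eigenvalues i = b := by
    intro i
    set v := hX.eigenvectorBasis i with hv
    set l := hX.eigenvalues i
    have hmul : ∀ j, b * v j + c * (∑ m, x m * v m) * x j = l * v j := by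
      intro j
      have := congrFun (hX.mulVec_eigenvectorBasis i) j
      simp only [Matrix.mulVec, dotProduct, h, Pi.smul_apply, smul_eq_mul, ← hv] at this
      change _ = l * v j at this
      rw [← this, Finset.mul_sum, Finset.sum_mul]
      simp only [add_mul, Finset.sum_add_distrib, ite_mul, zero_mul, Finset.sum_ite_eq,
        Finset.mem_univ, if_true]
      congr 1
      refine Finset.sum_congr rfl fun m _ => ?_
      ring
    by_cases hxv : ∑ m, x m * v m = 0
    · right
      by_contra hl
      have hv0 : v = 0 := by
        ext j
        have h1 := hmul j
        rw [hxv] at h1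
        have h2 : (l - b) * v j = 0 := by linarith
        exact (mul_eq_zero.1 h2).resolve_left (sub_ne_zero.2 hl)
      have h1 := hX.eigenvectorBasis.orthonormal.1 i
      rw [← hv, hv0, norm_zero] at h1
      exact zero_ne_one h1
    · left
      have h1 : ∑ j, x j * (b * v j + c * (∑ m, x m * v m) * x j) = ∑ j, x j * (l * v j) :=
        Finset.sum_congr rfl fun j _ => by rw [hmul j]
      have h2 : ∑ j, x j * (b * v j + c * (∑ m, x m * v m) * x j) =
          (b + c * ‖x‖ ^ 2) * ∑ m, x m * v m := by
        rw [hnorm]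
        generalize hS : ∑ m, x m * v m = S
        calc ∑ j, x j * (b * v j + c * S * x j)
            = ∑ j, (b * (x j * v j) + c * S * (x j * x j)) :=
              Finset.sum_congr rfl fun j _ => by ring
          _ = _ := by
              rw [Finset.sum_add_distrib, ← Finset.mul_sum, ← Finset.mul_sum, hS]
              ring
      have h3 : ∑ j, x j * (l * v j) = l * ∑ m, x m * v m := by
        rw [Finset.mul_sum]
        exact Finset.sum_congr rfl fun j _ => by ring
      rw [h2, h3] at h1
      exact (mul_right_cancel₀ hxv h1).symm
  have hsum : ∑ i, hX.eigenvalues i = b + c * ‖x‖ ^ 2 + (N - 1) * b := by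
    have := hX.trace_eq_sum_eigenvalues
    simp only [RCLike.ofReal_real_eq_id, id] at this
    rw [← this, Matrix.trace, hnorm]
    simp only [Matrix.diag_apply, h, if_true, Finset.sum_add_distrib, Finset.sum_const,
      Finset.card_univ, Fintype.card_fin, nsmul_eq_mul, ← Finset.mul_sum]
    ring
  have he0 : ∀ i, hX.eigenvalues₀ i =
      hX.eigenvalues (Fintype.equivOfCardEq (Fintype.card_fin _) i) := fun i => by
    simp [Matrix.IsHermitian.eigenvalues]
  have hcard : Fintype.card (Fin N) = N := Fintype.card_fin N
  rw [truncLaplacianPlus, dif_pos hX]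
  refine sum_filter_lt_of_antitone hk (by rwa [hcard]) hX.eigenvalues₀_antitone
    (fun i => by rw [he0]; exact heig _) ?_
  have hcast : ((Fintype.card (Fin N) : ℕ) : ℝ) = N := congrArg _ hcard
  rw [hcast, ← hsum]
  simp only [he0]
  exact Equiv.sum_comp _ hX.eigenvalues

/-- The Hessian of `f(|x|)` is `(f'/r) I + (f''/r² - f'/r³) x xᵀ`. -/
theorem hessianMatrix_radial {N : ℕ} {u : EuclideanSpace ℝ (Fin N) → ℝ} {f f' f'' : ℝ → ℝ}
    (hu : ∀ x ∈ Metric.ball (0 : EuclideanSpace ℝ (Fin N)) 1 \ {0}, u x = f ‖x‖)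
    (hf : ∀ r ∈ Set.Ioo (0 : ℝ) 1, HasDerivAt f (f' r) r)
    (hf' : ∀ r ∈ Set.Ioo (0 : ℝ) 1, HasDerivAt f' (f'' r) r)
    {x : EuclideanSpace ℝ (Fin N)} (hx : x ∈ Metric.ball (0 : EuclideanSpace ℝ (Fin N)) 1 \ {0})
    (i j : Fin N) :
    hessianMatrix u x i j = (if i = j then f' ‖x‖ / ‖x‖ else 0) +
      (f'' ‖x‖ / ‖x‖ ^ 2 - f' ‖x‖ / ‖x‖ ^ 3) * (x i * x j) := by
  have hopen : IsOpen (Metric.ball (0 : EuclideanSpace ℝ (Fin N)) 1 \ {0}) :=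
    Metric.isOpen_ball.sdiff isClosed_singleton
  have hmem : ∀ y ∈ Metric.ball (0 : EuclideanSpace ℝ (Fin N)) 1 \ {0},
      ‖y‖ ∈ Set.Ioo (0 : ℝ) 1 := fun y hy =>
    ⟨norm_pos_iff.2 hy.2, mem_ball_zero_iff.1 hy.1⟩
  have hnorm : ∀ y : EuclideanSpace ℝ (Fin N), y ≠ 0 →
      HasFDerivAt (fun y : EuclideanSpace ℝ (Fin N) => ‖y‖) (‖y‖⁻¹ • innerSL ℝ y) y := by
    intro y hy
    have h1 := ((hasStrictFDerivAt_norm_sq y).hasFDerivAt).sqrt (by positivity)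
    refine (h1.congr_of_eventuallyEq (Eventually.of_forall fun z => ?_)).congr_fderiv ?_
    · simp
    · rw [Real.sqrt_sq (norm_nonneg y)]
      ext v
      simp
      field_simp
  have hgrad : ∀ y ∈ Metric.ball (0 : EuclideanSpace ℝ (Fin N)) 1 \ {0},
      fderiv ℝ u y = (f' ‖y‖ / ‖y‖) • innerSL ℝ y := by
    intro y hy
    have h1 := (hf _ (hmem y hy)).comp_hasFDerivAt y (hnorm y hy.2)
    have h2 : u =ᶠ[𝓝 y] f ∘ fun y => ‖y‖ := by
      filter_upwards [hopen.mem_nhds hy] with w hw using hu w hw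
    rw [(h1.congr_of_eventuallyEq h2).fderiv, smul_smul, div_eq_mul_inv]
  have hr := hmem x hx
  have hr0 := hr.1.ne'
  have hψ : HasDerivAt (fun r => f' r / r) ((f'' ‖x‖ * ‖x‖ - f' ‖x‖ * 1) / ‖x‖ ^ 2) ‖x‖ :=
    (hf' _ hr).div (hasDerivAt_id _) hr0
  have h1 := (hψ.comp_hasFDerivAt x (hnorm x hx.2)).smul
    (innerSL ℝ (E := EuclideanSpace ℝ (Fin N))).hasFDerivAt
  have h2 : fderiv ℝ u =ᶠ[𝓝 x] fun y => (f' ‖y‖ / ‖y‖) • innerSL ℝ y := by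
    filter_upwards [hopen.mem_nhds hx] with w hw using hgrad w hw
  rw [hessianMatrix, Matrix.of_apply, (h1.congr_of_eventuallyEq h2).fderiv]
  have hij : inner ℝ (EuclideanSpace.single i (1 : ℝ)) (EuclideanSpace.single j (1 : ℝ)) =
      if i = j then (1 : ℝ) else 0 := by
    simp [EuclideanSpace.inner_single_left]
  have hxi : ∀ m, inner ℝ x (EuclideanSpace.single m (1 : ℝ)) = x m := fun m => by
    simp [EuclideanSpace.inner_single_right]
  change f' ‖x‖ / ‖x‖ * inner ℝ (EuclideanSpace.single i (1 : ℝ)) (EuclideanSpace.single j (1 : ℝ)) +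
    (f'' ‖x‖ * ‖x‖ - f' ‖x‖ * 1) / ‖x‖ ^ 2 * (‖x‖⁻¹ * inner ℝ x (EuclideanSpace.single i (1 : ℝ))) *
      inner ℝ x (EuclideanSpace.single j (1 : ℝ)) = _
  rw [hij, hxi, hxi, mul_ite, mul_one, mul_zero]
  congr 1
  field_simp

/-! ### Reduction to the planar system -/

/-- The radial equation in Emden–Fowler variables: `z = -r f' / f` and `w = r² f^{p - 1}` at
`r = e^{-t}`. -/
theorem emdenOrbit_of_radial {k μ p : ℝ} (hk : 2 < k) (hμ : 0 < μ) (hp : 1 < p)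
    {f f' f'' : ℝ → ℝ}
    (hf : ∀ r ∈ Set.Ioo (0 : ℝ) 1, HasDerivAt f (f' r) r)
    (hf' : ∀ r ∈ Set.Ioo (0 : ℝ) 1, HasDerivAt f' (f'' r) r)
    (hpos : ∀ r ∈ Set.Ioo (0 : ℝ) 1, 0 < f r)
    (heq : ∀ r ∈ Set.Ioo (0 : ℝ) 1,
      max (f'' r) (f' r / r) + (k - 1) * (f' r / r) + μ * (f r / r ^ 2) = f r ^ p) :
    EmdenOrbit k μ (p - 1) (2 / (p - 1))
      (fun t => -(Real.exp (-t) * f' (Real.exp (-t))) / f (Real.exp (-t)))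
      (fun t => Real.exp (-t) * f' (Real.exp (-t)) / f (Real.exp (-t)) +
        Real.exp (-t) ^ 2 * f'' (Real.exp (-t)) / f (Real.exp (-t)) -
        (Real.exp (-t) * f' (Real.exp (-t)) / f (Real.exp (-t))) ^ 2)
      (fun t => Real.exp (-t) ^ 2 * f (Real.exp (-t)) ^ (p - 1)) := by
  have hr : ∀ t > (0 : ℝ), Real.exp (-t) ∈ Set.Ioo (0 : ℝ) 1 := fun t ht =>
    ⟨Real.exp_pos _, by simpa using ht⟩
  have hexp : ∀ t : ℝ, HasDerivAt (fun t => Real.exp (-t)) (-Real.exp (-t)) t := fun t =>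
    ((hasDerivAt_neg t).exp).congr_deriv (by ring)
  have hp1 : p - 1 ≠ 0 := by linarith
  refine ⟨hk, hμ, by linarith, mul_div_cancel₀ _ hp1, fun t ht => ?_, fun t ht => ?_,
    fun t ht => ?_, fun t ht => ?_⟩
  · have h0 := hpos _ (hr t ht)
    have h1 := (hf _ (hr t ht)).comp t (hexp t)
    have h2 := (hf' _ (hr t ht)).comp t (hexp t)
    refine (((hexp t).mul h2).neg.div h1 h0.ne').congr_deriv ?_
    simp only [Function.comp, Pi.mul_apply, Pi.neg_apply]
    field_simp
    ring
  · have h0 := hpos _ (hr t ht)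
    have h1 := (hf _ (hr t ht)).comp t (hexp t)
    refine (((hexp t).pow 2).mul (h1.rpow_const (p := p - 1) (Or.inl h0.ne'))).congr_deriv ?_
    simp only [Function.comp, Pi.pow_apply]
    rw [Real.rpow_sub_one h0.ne' (p - 1)]
    field_simp
    ring
  · have h0 := hpos _ (hr t ht)
    have := Real.exp_pos (-t)
    positivity
  · have h0 := hpos _ (hr t ht)
    have hr0 := (hr t ht).1
    have h1 := heq _ (hr t ht)
    set r := Real.exp (-t)
    have h2 : f r ^ p = f r * f r ^ (p - 1) := by
      rw [Real.rpow_sub_one h0.ne']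
      field_simp
    -- the equation, multiplied by `r² / f`
    have h3 : r ^ 2 * f r ^ (p - 1) = max (r ^ 2 * f'' r / f r) (r * f' r / f r) +
        (k - 1) * (r * f' r / f r) + μ := by
      have h4 : r ^ 2 / f r * max (f'' r) (f' r / r) =
          max (r ^ 2 * f'' r / f r) (r * f' r / f r) := by
        rw [mul_max_of_nonneg _ _ (by positivity)]
        congr 1
        · ring
        · field_simp
      rw [← h4, ← sub_eq_zero]
      have h5 := sub_eq_zero.2 h1
      rw [h2] at h5
      have : r ^ 2 / f r * (max (f'' r) (f' r / r) + (k - 1) * (f' r / r) + μ * (f r / r ^ 2) -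
          f r * f r ^ (p - 1)) = 0 := by rw [h5, mul_zero]
      rw [← neg_eq_zero, ← this]
      field_simp
      ring
    rw [h3]
    have h6 : max (r ^ 2 * f'' r / f r) (r * f' r / f r) =
        max (r ^ 2 * f'' r / f r - r * f' r / f r) 0 + r * f' r / f r := by
      rw [← max_add_add_right, sub_add_cancel, zero_add]
    rw [h6, neg_div]
    have h7 : r * f' r / f r + r ^ 2 * f'' r / f r - (r * f' r / f r) ^ 2 +
        (-(r * f' r / f r)) ^ 2 + 2 * -(r * f' r / f r) =
        r ^ 2 * f'' r / f r - r * f' r / f r := by ring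
    rw [h7]
    ring

/-- A positive radial solution determines an orbit with `w = r² u^{p - 1}`, `r = e^{-t}`. -/
theorem exists_emdenOrbit {N k : ℕ} (hk : 3 ≤ k) (hkN : k < N) {μ p : ℝ} (hμ : 0 < μ) (hp : 1 < p)
    {u : EuclideanSpace ℝ (Fin N) → ℝ}
    (hu_C2 : ContDiffOn ℝ 2 u (Metric.ball 0 1 \ {0}))
    (hu_radial : ∃ f : ℝ → ℝ, ∀ x ∈ Metric.ball (0 : EuclideanSpace ℝ (Fin N)) 1 \ {0},
      u x = f ‖x‖)
    (hu_pos : ∀ x ∈ Metric.ball (0 : EuclideanSpace ℝ (Fin N)) 1 \ {0}, 0 < u x)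
    (hu_eq : ∀ x ∈ Metric.ball (0 : EuclideanSpace ℝ (Fin N)) 1 \ {0},
      truncLaplacianPlus k (hessianMatrix u x) + μ * (u x / ‖x‖ ^ 2) = u x ^ p) :
    ∃ z z' w : ℝ → ℝ, EmdenOrbit k μ (p - 1) (2 / (p - 1)) z z' w ∧
      ∀ x ∈ Metric.ball (0 : EuclideanSpace ℝ (Fin N)) 1 \ {0},
        w (-Real.log ‖x‖) = ‖x‖ ^ 2 * u x ^ (p - 1) := by
  obtain ⟨g, hg⟩ := hu_radial
  set e : EuclideanSpace ℝ (Fin N) := EuclideanSpace.single ⟨0, by omega⟩ 1 with he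
  have he1 : ‖e‖ = 1 := by simp [he]
  have hopen : IsOpen (Metric.ball (0 : EuclideanSpace ℝ (Fin N)) 1 \ {0}) :=
    Metric.isOpen_ball.sdiff isClosed_singleton
  have hnorm : ∀ r ∈ Set.Ioo (0 : ℝ) 1, ‖r • e‖ = r := fun r hr => by
    rw [norm_smul, he1, mul_one, Real.norm_of_nonneg hr.1.le]
  have hmem : ∀ r ∈ Set.Ioo (0 : ℝ) 1,
      r • e ∈ Metric.ball (0 : EuclideanSpace ℝ (Fin N)) 1 \ {0} := fun r hr => by
    refine ⟨mem_ball_zero_iff.2 ((hnorm r hr).trans_lt hr.2), norm_pos_iff.1 ?_⟩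
    rw [hnorm r hr]
    exact hr.1
  have hmem' : ∀ x ∈ Metric.ball (0 : EuclideanSpace ℝ (Fin N)) 1 \ {0},
      ‖x‖ ∈ Set.Ioo (0 : ℝ) 1 := fun x hx => ⟨norm_pos_iff.2 hx.2, mem_ball_zero_iff.1 hx.1⟩
  set f : ℝ → ℝ := fun r => u (r • e) with hfdef
  have hu : ∀ x ∈ Metric.ball (0 : EuclideanSpace ℝ (Fin N)) 1 \ {0}, u x = f ‖x‖ := fun x hx => by
    rw [hg x hx, hfdef]
    simp only
    rw [hg _ (hmem _ (hmem' x hx)), hnorm _ (hmem' x hx)]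
  have hfC : ContDiffOn ℝ 2 f (Set.Ioo 0 1) :=
    hu_C2.comp (contDiff_id.smul contDiff_const).contDiffOn hmem
  have hf : ∀ r ∈ Set.Ioo (0 : ℝ) 1, HasDerivAt f (deriv f r) r := fun r hr =>
    ((hfC.contDiffAt (Ioo_mem_nhds hr.1 hr.2)).differentiableAt (by norm_num)).hasDerivAt
  have hf' : ∀ r ∈ Set.Ioo (0 : ℝ) 1, HasDerivAt (deriv f) (deriv (deriv f) r) r := fun r hr => by
    have h1 : ContDiffOn ℝ 1 (deriv f) (Set.Ioo 0 1) :=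
      hfC.deriv_of_isOpen isOpen_Ioo (by norm_num)
    exact ((h1.contDiffAt (Ioo_mem_nhds hr.1 hr.2)).differentiableAt (by norm_num)).hasDerivAt
  have hk' : (2 : ℝ) < k := by exact_mod_cast hk
  refine ⟨_, _, _, emdenOrbit_of_radial hk' hμ hp hf hf' (fun r hr => hu_pos _ (hmem r hr)) ?_, ?_⟩
  · intro r hr
    have h1 := hu_eq _ (hmem r hr)
    have hr0 := hr.1.ne'
    rw [truncLaplacianPlus_eq (by omega) hkN
      (hessianMatrix_isHermitian (hu_C2.contDiffAt (hopen.mem_nhds (hmem r hr))))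
      (hessianMatrix_radial hu hf hf' (hmem r hr)), hnorm r hr] at h1
    rw [← h1]
    congr 3
    field_simp
    ring
  · intro x hx
    simp only [neg_neg]
    rw [Real.exp_log (hmem' x hx).1, hu x hx]

/-! ### Asymptotics at the origin -/

/-- Limits at the origin as limits in `t = -log |x|`. -/
theorem tendsto_punctured_of_tendsto_atTop {N : ℕ} {G : EuclideanSpace ℝ (Fin N) → ℝ} {g : ℝ → ℝ}
    {c : ℝ} (hg : Tendsto g atTop (𝓝 c))
    (hG : ∀ x ∈ Metric.ball (0 : EuclideanSpace ℝ (Fin N)) 1 \ {0}, g (-Real.log ‖x‖) = G x) :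
    Tendsto G (𝓝[≠] 0) (𝓝 c) := by
  have hlog : Tendsto (fun x : EuclideanSpace ℝ (Fin N) => -Real.log ‖x‖) (𝓝[≠] 0) atTop :=
    tendsto_neg_atBot_atTop.comp (Real.tendsto_log_nhdsGT_zero.comp tendsto_norm_nhdsNE_zero)
  refine (hg.comp hlog).congr' ?_
  filter_upwards [sdiff_mem_nhdsWithin_compl (Metric.ball_mem_nhds _ one_pos) {0}] with x hx
    using hG x hx

section

variable {N : ℕ} {u : EuclideanSpace ℝ (Fin N) → ℝ} {p : ℝ} {w : ℝ → ℝ}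

theorem hasPowerLimit_of_tendsto (hp : 1 < p)
    (hu_pos : ∀ x ∈ Metric.ball (0 : EuclideanSpace ℝ (Fin N)) 1 \ {0}, 0 < u x)
    (hw : ∀ x ∈ Metric.ball (0 : EuclideanSpace ℝ (Fin N)) 1 \ {0},
      w (-Real.log ‖x‖) = ‖x‖ ^ 2 * u x ^ (p - 1)) {b : ℝ} (hb : Tendsto w atTop (𝓝 b)) :
    HasPowerLimit u (2 / (p - 1)) (b ^ (1 / (p - 1))) := by
  have hp1 : 0 < p - 1 := by linarith
  refine tendsto_punctured_of_tendsto_atTop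
    (hb.rpow_const (p := 1 / (p - 1)) (Or.inr (by positivity))) fun x hx => ?_
  have hx0 : 0 < ‖x‖ := norm_pos_iff.2 hx.2
  have hux := hu_pos x hx
  rw [hw x hx, Real.mul_rpow (by positivity) (by positivity), ← Real.rpow_natCast,
    ← Real.rpow_mul hx0.le, ← Real.rpow_mul hux.le, mul_one_div_cancel hp1.ne', Real.rpow_one]
  congr 2
  push_cast
  ring

/-- The function of `t` in the hypothesis is `log (r^l u)` at `r = e^{-t}`. -/
theorem hasPowerLimit_of_tendsto_log (hp : 1 < p)
    (hu_pos : ∀ x ∈ Metric.ball (0 : EuclideanSpace ℝ (Fin N)) 1 \ {0}, 0 < u x)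
    (hw : ∀ x ∈ Metric.ball (0 : EuclideanSpace ℝ (Fin N)) 1 \ {0},
      w (-Real.log ‖x‖) = ‖x‖ ^ 2 * u x ^ (p - 1)) {l C : ℝ}
    (hC : Tendsto (fun t => Real.log (w t) / (p - 1) + (2 / (p - 1) - l) * t) atTop (𝓝 C)) :
    HasPowerLimit u l (Real.exp C) := by
  have hp1 : 0 < p - 1 := by linarith
  refine tendsto_punctured_of_tendsto_atTop ((Real.continuous_exp.tendsto C).comp hC)
    fun x hx => ?_
  have hx0 : 0 < ‖x‖ := norm_pos_iff.2 hx.2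
  have hux := hu_pos x hx
  rw [Function.comp, hw x hx, Real.log_mul (by positivity) (by positivity), Real.log_pow,
    Real.log_rpow hux, Real.rpow_def_of_pos hx0]
  refine Eq.trans ?_ (congrArg (_ * ·) (Real.exp_log hux))
  rw [← Real.exp_add]
  congr 1
  field_simp
  push_cast
  ring

theorem tendsto_mul_log_of_tendsto_mul (hp : 1 < p)
    (hu_pos : ∀ x ∈ Metric.ball (0 : EuclideanSpace ℝ (Fin N)) 1 \ {0}, 0 < u x)
    (hw : ∀ x ∈ Metric.ball (0 : EuclideanSpace ℝ (Fin N)) 1 \ {0},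
      w (-Real.log ‖x‖) = ‖x‖ ^ 2 * u x ^ (p - 1)) {b : ℝ}
    (hb : Tendsto (fun t => w t * t) atTop (𝓝 b)) :
    Tendsto (fun x => ‖x‖ ^ (2 / (p - 1)) * (-Real.log ‖x‖) ^ (1 / (p - 1)) * u x) (𝓝[≠] 0)
      (𝓝 (b ^ (1 / (p - 1)))) := by
  have hp1 : 0 < p - 1 := by linarith
  refine tendsto_punctured_of_tendsto_atTop
    (hb.rpow_const (p := 1 / (p - 1)) (Or.inr (by positivity))) fun x hx => ?_
  have hx0 : 0 < ‖x‖ := norm_pos_iff.2 hx.2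
  have hlog : 0 < -Real.log ‖x‖ := neg_pos.2 (Real.log_neg hx0 (mem_ball_zero_iff.1 hx.1))
  have hux := hu_pos x hx
  rw [hw x hx, Real.mul_rpow (by positivity) hlog.le, Real.mul_rpow (by positivity) (by positivity),
    ← Real.rpow_natCast, ← Real.rpow_mul hx0.le, ← Real.rpow_mul hux.le,
    mul_one_div_cancel hp1.ne', Real.rpow_one, Nat.cast_ofNat, mul_one_div]
  ring

end

theorem indicial_eq {k : ℕ} {μ : ℝ} (hμ : μ < (((k : ℝ) - 2) / 2) ^ 2) (x : ℝ) :
    indicial k μ x = (x - tauPlus k μ) * (x - tauMinus k μ) := by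
  have := Real.sq_sqrt (sub_pos.2 hμ).le
  unfold indicial tauPlus tauMinus
  linear_combination this

theorem tauMinus_pos {k : ℕ} (hk : 3 ≤ k) {μ : ℝ} (hμ : 0 < μ) : 0 < tauMinus k μ := by
  have hk' : (3 : ℝ) ≤ k := by exact_mod_cast hk
  rw [tauMinus, sub_pos, Real.sqrt_lt' (by linarith)]
  linarith

theorem mainTheorem2 (N k : ℕ) (hk : 3 ≤ k) (hkN : k < N)
    (μ p : ℝ) (hμ_pos : 0 < μ) (hμ_lt : μ < (((k : ℝ) - 2) / 2) ^ 2) (hp : 1 < p)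
    (u : EuclideanSpace ℝ (Fin N) → ℝ)
    (hu_C2 : ContDiffOn ℝ 2 u (Metric.ball 0 1 \ {0}))
    (hu_radial : ∃ f : ℝ → ℝ, ∀ x ∈ Metric.ball (0 : EuclideanSpace ℝ (Fin N)) 1 \ {0},
      u x = f ‖x‖)
    (hu_pos : ∀ x ∈ Metric.ball (0 : EuclideanSpace ℝ (Fin N)) 1 \ {0}, 0 < u x)
    (hu_eq : ∀ x ∈ Metric.ball (0 : EuclideanSpace ℝ (Fin N)) 1 \ {0},
      truncLaplacianPlus k (hessianMatrix u x) + μ * (u x / ‖x‖ ^ 2) = u x ^ p) :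
    (p < pStar k μ →
      HasPowerLimit u (2 / (p - 1)) (constK k μ p) ∨
      (∃ c : ℝ, 0 < c ∧ HasPowerLimit u (tauPlus k μ) c) ∨
      (∃ c : ℝ, 0 < c ∧ HasPowerLimit u (tauMinus k μ) c)) ∧
    (pStar k μ ≤ p → p < pStarStar k μ →
      ∃ c : ℝ, 0 < c ∧ HasPowerLimit u (tauMinus k μ) c) ∧
    (p = pStarStar k μ →
      Tendsto (fun x => ‖x‖ ^ tauMinus k μ * (-Real.log ‖x‖) ^ (tauMinus k μ / 2) * u x)
        (𝓝[≠] 0) (𝓝 (constKBar k μ))) ∧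
    (pStarStar k μ < p →
      HasPowerLimit u (2 / (p - 1)) (constK k μ p)) := by
  obtain ⟨z, z', w, h, hw⟩ := exists_emdenOrbit hk hkN hμ_pos hp hu_C2 hu_radial hu_pos hu_eq
  have hp1 : 0 < p - 1 := by linarith
  have hF : ∀ x, indicial k μ x = (x - tauPlus k μ) * (x - tauMinus k μ) := indicial_eq hμ_lt
  have hm : 0 < tauMinus k μ := tauMinus_pos hk hμ_pos
  have hD : 0 < √((((k : ℝ) - 2) / 2) ^ 2 - μ) := Real.sqrt_pos.2 (sub_pos.2 hμ_lt)
  have hdiff : tauPlus k μ = tauMinus k μ + 2 * √((((k : ℝ) - 2) / 2) ^ 2 - μ) := by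
    unfold tauPlus tauMinus
    ring
  have hlt : tauMinus k μ < tauPlus k μ := by linarith
  have hps : ∀ τ : ℝ, 0 < τ → (p < 1 + 2 / τ ↔ τ < 2 / (p - 1)) := fun τ hτ => by
    rw [← sub_lt_iff_lt_add', lt_div_iff₀ hτ, lt_div_iff₀ hp1, mul_comm]
  have hps' : ∀ τ : ℝ, 0 < τ → (1 + 2 / τ < p ↔ 2 / (p - 1) < τ) := fun τ hτ => by
    rw [← lt_sub_iff_add_lt', div_lt_iff₀ hτ, div_lt_iff₀ hp1, mul_comm]
  have hK : Tendsto w atTop (𝓝 (indicial k μ (2 / (p - 1)))) →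
      HasPowerLimit u (2 / (p - 1)) (constK k μ p) := fun hlim => by
    rw [constK, ← hF]
    exact hasPowerLimit_of_tendsto hp hu_pos hw hlim
  have hroot : ∀ l, indicial k μ l = 0 → l = tauPlus k μ ∨ l = tauMinus k μ := fun l hl => by
    rw [hF] at hl
    exact (mul_eq_zero.1 hl).imp sub_eq_zero.1 sub_eq_zero.1
  have hplus : tauPlus k μ < 2 / (p - 1) → Tendsto w atTop (𝓝 0) →
      Tendsto z atTop (𝓝 (tauPlus k μ)) →
      ∃ c : ℝ, 0 < c ∧ HasPowerLimit u (tauPlus k μ) c := fun hα hw0 hz => by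
    obtain ⟨C, hC⟩ := h.exists_tendsto_log hF hlt.ne' hα hw0 hz
    exact ⟨_, Real.exp_pos C, hasPowerLimit_of_tendsto_log hp hu_pos hw hC⟩
  have hminus : tauMinus k μ < 2 / (p - 1) → Tendsto w atTop (𝓝 0) →
      Tendsto z atTop (𝓝 (tauMinus k μ)) →
      ∃ c : ℝ, 0 < c ∧ HasPowerLimit u (tauMinus k μ) c := fun hα hw0 hz => by
    obtain ⟨C, hC⟩ := h.exists_tendsto_log (fun x => (hF x).trans (mul_comm _ _)) hlt.ne hα hw0 hz
    exact ⟨_, Real.exp_pos C, hasPowerLimit_of_tendsto_log hp hu_pos hw hC⟩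
  have hcases := h.tendsto_or_tendsto
  set α := 2 / (p - 1) with hαdef
  refine ⟨fun hcase => ?_, fun hcase₁ hcase₂ => ?_, fun hcase => ?_, fun hcase => ?_⟩
  · have hα : tauPlus k μ < α := (hps _ (hm.trans hlt)).1 hcase
    rcases hcases with ⟨-, hlim⟩ | ⟨hw0, -, l, -, hl, hz⟩
    · exact Or.inl (hK hlim)
    · rcases hroot l hl with rfl | rfl
      · exact Or.inr (Or.inl (hplus hα hw0 hz))
      · exact Or.inr (Or.inr (hminus (hlt.trans hα) hw0 hz))
  · have hα₁ : α ≤ tauPlus k μ := not_lt.1 fun hα =>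
      absurd ((hps _ (hm.trans hlt)).2 hα) (not_lt.2 hcase₁)
    have hα₂ : tauMinus k μ < α := (hps _ hm).1 hcase₂
    rcases hcases with ⟨hpos, -⟩ | ⟨hw0, hzα, l, hlα, hl, hz⟩
    · rw [hF] at hpos
      exact absurd hpos (not_lt.2
        (mul_nonpos_of_nonpos_of_nonneg (sub_nonpos.2 hα₁) (sub_nonneg.2 hα₂.le)))
    · rcases hroot l hl with rfl | rfl
      · have hα : tauPlus k μ = α := le_antisymm hlα hα₁
        rw [hα] at hF hz
        exact absurd hz (h.not_tendsto_larger_root hF hα₂ hw0 hzα)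
      · exact hminus hα₂ hw0 hz
  · have hα : α = tauMinus k μ := by
      have hτ : p - 1 = 2 / tauMinus k μ := by
        rw [hcase, pStarStar]
        ring
      rw [hαdef, hτ, div_div_cancel₀ two_ne_zero]
    rcases hcases with ⟨hpos, -⟩ | ⟨-, hzα, l, hlα, hl, hz⟩
    · rw [hF, hα, sub_self, mul_zero] at hpos
      exact absurd hpos (lt_irrefl 0)
    · have hl' : l = α := by
        rcases hroot l hl with rfl | rfl
        · linarith
        · exact hα.symm
      rw [hl'] at hz
      have hlim := h.tendsto_mul_of_smaller_root (mul_pos two_pos hD) (fun x => by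
        rw [hF, hα, hdiff, mul_comm]) hzα hz
      have hexp : 1 / (p - 1) = tauMinus k μ / 2 := by
        rw [← hα, hαdef]
        ring
      have hconst : 2 * √((((k : ℝ) - 2) / 2) ^ 2 - μ) / (p - 1) =
          tauMinus k μ * √((((k : ℝ) - 2) / 2) ^ 2 - μ) := by
        rw [← hα, hαdef]
        ring
      have := tendsto_mul_log_of_tendsto_mul hp hu_pos hw hlim
      rw [hexp, hconst, ← hαdef, hα] at this
      exact this
  · have hα : α < tauMinus k μ := (hps' _ hm).1 hcase
    rcases hcases with ⟨-, hlim⟩ | ⟨-, -, l, hlα, hl, -⟩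
    · exact hK hlim
    · rcases hroot l hl with rfl | rfl <;> linarith
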